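/- Let $n\ge 0$ and $d \ge 1$ be integers, let $\Omega\subset\mathbb{R}^n$ be open and bounded, let $S^{d-1}$ denote the Euclidean unit sphere of $\mathbb{R}^d$, and let $\mathcal{M}(\Omega;\mathbb{R}^d)$ denote the space of $\mathbb{R}^d$-valued finite Radon measures on $\Omega$; for $\mu\in\mathcal{M}(\Omega;\mathbb{R}^d)$ let $|\mu|$ be its total variation measure. Let $$f\colon \overline{\Omega}\times[0,1]\times S^{d-1}\times S^{d-1}\to\mathbb{R}$$ be lower semi-continuous and bounded, and assume that for every $x\in\Omega$ the mappings $(\xi,\zeta)\mapsto f(x,0,\xi,\zeta)$ and $(\xi,\zeta)\mapsto f(x,1,\xi,\zeta)$ are constant on $S^{d-1}\times S^{d-1}$, and that for every $x\in\Omega$ and all $\xi,\zeta\in S^{d-1}$ the mapping $\tau\mapsto f(x,\tau,\xi,\zeta)$ is convex on $[0,1]$. For $\mu,\nu\in\mathcal{M}(\Omega;\mathbb{R}^d)$ define $$F(\mu,\nu)=\int_\Omega f\Bigl(x,\frac{d|\mu|}{d(|\mu|+|\nu|)}(x),\frac{d\mu}{d|\mu|}(x),\frac{d\nu}{d|\nu|}(x)\Bigr)\,d(|\mu|+|\nu|)(x),$$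 where $d\mu/d|\mu|$ and $d\nu/d|\nu|$ are measurable $S^{d-1}$-valued versions of the Radon–Nikodym densities and $d|\mu|/d(|\mu|+|\nu|)$ takes values in $[0,1]$ (because $f(x,\tau,\cdot,\cdot)$ is constant for $\tau\in\{0,1\}$, the integral does not depend on the versions chosen). Then $F$ is lower semi-continuous with respect to strict convergence in both components. That is: let $\mu_k,\mu,\nu_k,\nu\in\mathcal{M}(\Omega;\mathbb{R}^d)$, $k\in\mathbb{N}$, be such that $\int_\Omega\psi\,d\mu_k\to\int_\Omega\psi\,d\mu$ and $\int_\Omega\psi\,d\nu_k\to\int_\Omega\psi\,d\nu$ for every $\psi\in C_0(\Omega)$ (the continuous real functions on $\Omega$ vanishing at infinity), and such that $|\mu_k|(\Omega)\to|\mu|(\Omega)$ and $|\nu_k|(\Omega)\to|\nu|(\Omega)$. Then $$F(\mu,\nu)\le\liminf_{k\to\infty}F(\mu_k,\nu_k).$$ -/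

import Mathlib

open MeasureTheory Filter Topology Set
open scoped ZeroAtInfty ENNReal

noncomputable section

namespace TwoMeasures

/-- The Euclidean space `ℝ^d`. -/
abbrev Vec (d : ℕ) : Type := EuclideanSpace ℝ (Fin d)

/-- The unit sphere `S^{d-1}` of `ℝ^d`. -/
abbrev USphere (d : ℕ) : Type := Metric.sphere (0 : Vec d) 1

/-- The space `𝓜(X; ℝ^d)` of `ℝ^d`-valued (automatically finite) Borel measures. -/
abbrev VMeas (X : Type*) [MeasurableSpace X] (d : ℕ) : Type _ := VectorMeasure X (Vec d)

section Measures

variable {X : Type*} [MeasurableSpace X] {d : ℕ}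

/-- The `i`-th component of a vector measure, a signed measure. -/
def component (μ : VMeas X d) (i : Fin d) : SignedMeasure X :=
  μ.mapRange (EuclideanSpace.proj i : Vec d →L[ℝ] ℝ).toLinearMap.toAddMonoidHom
    (EuclideanSpace.proj i : Vec d →L[ℝ] ℝ).continuous

/-- The Radon–Nikodym density `dμ/d|μ|`, computed component by component, where `|μ|` is the total
variation measure `μ.variation`. -/
def polarDensity (μ : VMeas X d) (x : X) : Vec d :=
  WithLp.toLp 2 fun i => (component μ i).rnDeriv μ.variation x

/-- Some unit vector, for `d ≥ 1`. -/
def someUnit (d : ℕ) [NeZero d] : USphere d :=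
  ⟨EuclideanSpace.single 0 1, by simp⟩

open Classical in
/-- The density `dμ/d|μ|` as a function with values in the unit sphere. The density has norm one
`|μ|`-almost everywhere; on the remaining `|μ|`-null set an arbitrary fixed unit vector is used. -/
def direction [NeZero d] (μ : VMeas X d) (x : X) : USphere d :=
  if h : polarDensity μ x ∈ Metric.sphere (0 : Vec d) 1 then ⟨polarDensity μ x, h⟩ else someUnit d

/-- The density `d|μ|/d(|μ|+|ν|)` as a function with values in `[0,1]`. (It lies in `[0,1]` almost
everywhere, so that the projection onto `[0,1]` changes it on a null set only.) -/
def ratio (μ ν : VMeas X d) (x : X) : Icc (0 : ℝ) 1 :=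
  projIcc 0 1 zero_le_one (μ.variation.rnDeriv (μ.variation + ν.variation) x).toReal

/-- Strict convergence `μ_k → μ` : weak-* convergence in the duality with `C₀(X)`, and convergence
of the total masses `|μ_k|(X) → |μ|(X)`. -/
def StrictConverges [TopologicalSpace X] (μs : ℕ → VMeas X d) (μ : VMeas X d) : Prop :=
  (∀ ψ : C₀(X, ℝ), Tendsto (fun k => ∫ᵛ x, ψ x ∂•(μs k)) atTop (𝓝 (∫ᵛ x, ψ x ∂•μ))) ∧
    Tendsto (fun k => (μs k).variation univ) atTop (𝓝 (μ.variation univ))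

end Measures

section Functional

variable {n d : ℕ}

/-- The domain `closure Ω × Σ × S^{d-1} × S^{d-1}` of the integrands, with the one-dimensional unit
simplex `Σ` identified with `[0,1]`. -/
abbrev Dom (Ω : Set (EuclideanSpace ℝ (Fin n))) (d : ℕ) : Type :=
  closure Ω × Icc (0 : ℝ) 1 × USphere d × USphere d

/-- A point of `Ω`, regarded as a point of the closure of `Ω`. -/
def toClosure {Ω : Set (EuclideanSpace ℝ (Fin n))} (x : Ω) : closure Ω :=
  Set.inclusion subset_closure x

/-- The integrand `f(x, d|μ|/d(|μ|+|ν|), dμ/d|μ|, dν/d|ν|)`. -/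
def integrand [NeZero d] {Ω : Set (EuclideanSpace ℝ (Fin n))} (f : Dom Ω d → ℝ)
    (μ ν : VMeas Ω d) (x : Ω) : ℝ :=
  f (toClosure x, ratio μ ν x, direction μ x, direction ν x)

/-- The functional `F(μ,ν) = ∫_Ω f(x, d|μ|/d(|μ|+|ν|), dμ/d|μ|, dν/d|ν|) d(|μ|+|ν|)`. -/
def functional [NeZero d] {Ω : Set (EuclideanSpace ℝ (Fin n))} (f : Dom Ω d → ℝ)
    (μ ν : VMeas Ω d) : ℝ :=
  ∫ x, integrand f μ ν x ∂(μ.variation + ν.variation)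

end Functional

/-! Facts showing that the objects above are well defined. -/

section Facts

variable {X : Type*} [MeasurableSpace X] {d : ℕ}

lemma component_apply (μ : VMeas X d) (i : Fin d) (s : Set X) : component μ i s = μ s i := rfl

instance isFiniteMeasure_variation (μ : VMeas X d) : IsFiniteMeasure μ.variation := by
  have h : μ.variation ≤ ∑ i, (component μ i).totalVariation := by
    refine VectorMeasure.variation_le_of_forall_enorm_le fun E _ => ?_
    have h1 : ‖μ E‖ₑ ≤ ∑ i, ‖component μ i E‖ₑ := by
      have h2 : μ E = ∑ i, EuclideanSpace.single i (μ E i) := by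
        ext j
        simp [Finset.sum_apply]
      calc ‖μ E‖ₑ = ‖∑ i, EuclideanSpace.single i (μ E i)‖ₑ := by rw [← h2]
        _ ≤ ∑ i, ‖EuclideanSpace.single i (μ E i)‖ₑ := enorm_sum_le _ _
        _ = _ := by
          refine Finset.sum_congr rfl fun i _ => ?_
          rw [component_apply, ← ofReal_norm, ← ofReal_norm, PiLp.norm_single]
    refine h1.trans ?_
    rw [Measure.finsetSum_apply]
    exact Finset.sum_le_sum fun i _ => SignedMeasure.enorm_le_totalVariation _ _
  refine ⟨(h univ).trans_lt ?_⟩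
  rw [Measure.finsetSum_apply]
  refine ENNReal.sum_lt_top.2 fun _ _ => ?_
  simp [SignedMeasure.totalVariation]

lemma measurable_polarDensity (μ : VMeas X d) : Measurable (polarDensity μ) :=
  (WithLp.measurable_toLp 2 _).comp
    (measurable_pi_lambda _ fun i => SignedMeasure.measurable_rnDeriv _ _)

lemma integrable_polarDensity (μ : VMeas X d) : Integrable (polarDensity μ) μ.variation := by
  have h : ∀ i, Integrable (fun x => polarDensity μ x i) μ.variation := fun i =>
    SignedMeasure.integrable_rnDeriv _ _
  exact Integrable.of_eval_piLp h

/-- `polarDensity μ` is a density of `μ` with respect to its total variation. -/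
lemma withDensity_polarDensity (μ : VMeas X d) :
    μ.variation.withDensityᵥ (polarDensity μ) = μ := by
  ext s hs i
  rw [withDensityᵥ_apply (integrable_polarDensity μ) hs]
  have hac : component μ i ≪ᵥ μ.variation.toENNRealVectorMeasure := by
    refine VectorMeasure.AbsolutelyContinuous.mk fun t ht h0 => ?_
    rw [Measure.toENNRealVectorMeasure_apply_measurable ht] at h0
    have : ‖μ t‖ₑ ≤ 0 := h0 ▸ VectorMeasure.enorm_measure_le_variation μ t
    have : μ t = 0 := by simpa using this
    rw [component_apply, this]; rfl
  have h := SignedMeasure.withDensityᵥ_rnDeriv_eq (component μ i) μ.variation hac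
  have h2 : μ.variation.withDensityᵥ ((component μ i).rnDeriv μ.variation) s =
      component μ i s := by rw [h]
  rw [withDensityᵥ_apply (SignedMeasure.integrable_rnDeriv _ _) hs] at h2
  rw [← component_apply, ← h2]
  exact ((EuclideanSpace.proj i : Vec d →L[ℝ] ℝ).integral_comp_comm
    (integrable_polarDensity μ).integrableOn).symm

lemma norm_density_eq_one {μ : VMeas X d} {g : X → Vec d} (hg : Integrable g μ.variation)
    (h : μ.variation.withDensityᵥ g = μ) : ∀ᵐ x ∂μ.variation, ‖g x‖ = 1 := by
  have h1 := Measure.variation_withDensityᵥ hg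
  rw [h] at h1
  have h2 : μ.variation.withDensity (fun x => ‖g x‖ₑ) = μ.variation.withDensity 1 := by
    rw [withDensity_one, ← h1]
  have h3 := (withDensity_eq_iff_of_sigmaFinite hg.aestronglyMeasurable.enorm
    aemeasurable_const).1 h2
  filter_upwards [h3] with x hx
  have h4 : ‖g x‖ₑ = 1 := hx
  rw [← toReal_enorm, h4, ENNReal.toReal_one]

lemma measurable_ratio (μ ν : VMeas X d) : Measurable (ratio μ ν) :=
  continuous_projIcc.measurable.comp (Measure.measurable_rnDeriv _ _).ennreal_toReal

/-- `ratio μ ν` is a density of `|μ|` with respect to `|μ| + |ν|`. -/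
lemma withDensity_ratio (μ ν : VMeas X d) :
    (μ.variation + ν.variation).withDensity (fun x => ENNReal.ofReal (ratio μ ν x)) =
      μ.variation := by
  have hac : μ.variation ≪ μ.variation + ν.variation :=
    Measure.absolutelyContinuous_of_le (Measure.le_add_right le_rfl)
  conv_rhs => rw [← Measure.withDensity_rnDeriv_eq _ _ hac]
  refine withDensity_congr_ae ?_
  have h1 : μ.variation.rnDeriv (μ.variation + ν.variation) ≤ᵐ[μ.variation + ν.variation] 1 := by
    refine ae_le_of_forall_setLIntegral_le_of_sigmaFinite (Measure.measurable_rnDeriv _ _) ?_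
    intro s hs _
    rw [← withDensity_apply _ hs, Measure.withDensity_rnDeriv_eq _ _ hac]
    simp
  filter_upwards [h1] with x hx
  have hx1 : μ.variation.rnDeriv (μ.variation + ν.variation) x ≤ 1 := hx
  have hx2 : (μ.variation.rnDeriv (μ.variation + ν.variation) x).toReal ≤ 1 :=
    ENNReal.toReal_le_of_le_ofReal zero_le_one (by simpa using hx1)
  rw [ratio, projIcc_of_mem zero_le_one ⟨ENNReal.toReal_nonneg, hx2⟩]
  exact ENNReal.ofReal_toReal (hx1.trans_lt ENNReal.one_lt_top).ne

variable [NeZero d]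

lemma direction_ae_eq (μ : VMeas X d) :
    (fun x => (direction μ x : Vec d)) =ᵐ[μ.variation] polarDensity μ := by
  filter_upwards [norm_density_eq_one (integrable_polarDensity μ) (withDensity_polarDensity μ)]
    with x hx
  simp [direction, hx]

lemma measurable_direction (μ : VMeas X d) : Measurable (direction μ) := by
  classical
  have hs : MeasurableSet {x | polarDensity μ x ∈ Metric.sphere (0 : Vec d) 1} :=
    measurable_polarDensity μ Metric.isClosed_sphere.measurableSet
  exact Measurable.dite (f := fun x => (⟨polarDensity μ x.1, x.2⟩ : USphere d))
    (g := fun _ => someUnit d)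
    (((measurable_polarDensity μ).comp measurable_subtype_coe).subtype_mk (h := fun x => x.2)) measurable_const hs

/-- `direction μ` is a density of `μ` with respect to its total variation. -/
lemma withDensity_direction (μ : VMeas X d) :
    μ.variation.withDensityᵥ (fun x => (direction μ x : Vec d)) = μ := by
  conv_rhs => rw [← withDensity_polarDensity μ]
  exact WithDensityᵥEq.congr_ae (direction_ae_eq μ)

lemma ratio_eq_zero_or_ae_eq {μ ν : VMeas X d} {m : X → USphere d} (hm : Measurable m)
    (h : μ.variation.withDensityᵥ (fun x => (m x : Vec d)) = μ) :
    ∀ᵐ x ∂(μ.variation + ν.variation), (ratio μ ν x : ℝ) = 0 ∨ direction μ x = m x := by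
  have hi : ∀ g : X → USphere d, Measurable g →
      Integrable (fun x => (g x : Vec d)) μ.variation := fun g hg =>
    Integrable.of_bound (measurable_subtype_coe.comp hg).aestronglyMeasurable 1
      (ae_of_all _ fun x => by simp)
  have h1 := (hi _ (measurable_direction μ)).ae_eq_of_withDensityᵥ_eq (hi m hm)
    ((withDensity_direction μ).trans h.symm)
  rw [← withDensity_ratio μ ν] at h1
  have h2 := (ae_withDensity_iff
    (measurable_subtype_coe.comp (measurable_ratio μ ν)).ennreal_ofReal).1 h1
  filter_upwards [h2] with x hx
  by_cases h0 : (ratio μ ν x : ℝ) = 0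
  · exact Or.inl h0
  · right
    refine Subtype.ext (hx ?_)
    have : 0 < (ratio μ ν x : ℝ) := lt_of_le_of_ne (ratio μ ν x).2.1 (Ne.symm h0)
    simpa using this

lemma ratio_eq_one_or_ae_eq {μ ν : VMeas X d} {m : X → USphere d} (hm : Measurable m)
    (h : ν.variation.withDensityᵥ (fun x => (m x : Vec d)) = ν) :
    ∀ᵐ x ∂(μ.variation + ν.variation), (ratio μ ν x : ℝ) = 1 ∨ direction ν x = m x := by
  have h1 := ratio_eq_zero_or_ae_eq (ν := μ) hm h
  rw [add_comm] at h1
  have hmeas : ∀ α β : VMeas X d, Measurable fun x => ENNReal.ofReal (ratio α β x) := fun α β =>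
    (measurable_subtype_coe.comp (measurable_ratio α β)).ennreal_ofReal
  have h2 : (μ.variation + ν.variation).withDensity
      ((fun x => ENNReal.ofReal (ratio μ ν x)) + fun x => ENNReal.ofReal (ratio ν μ x)) =
      (μ.variation + ν.variation).withDensity 1 := by
    rw [withDensity_add_left (hmeas μ ν), withDensity_ratio, add_comm μ.variation ν.variation,
      withDensity_ratio, withDensity_one, add_comm]
  have h3 := (withDensity_eq_iff_of_sigmaFinite
    ((hmeas μ ν).add (hmeas ν μ)).aemeasurable aemeasurable_const).1 h2
  filter_upwards [h1, h3] with x hx hx3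
  refine hx.imp (fun h0 => ?_) id
  have h4 : ENNReal.ofReal (ratio μ ν x) + ENNReal.ofReal (ratio ν μ x) = 1 := hx3
  simpa [h0] using h4

end Facts

section WellDefined

variable {n d : ℕ} [NeZero d] {Ω : Set (EuclideanSpace ℝ (Fin n))} {f : Dom Ω d → ℝ}

lemma measurable_integrand (hf : LowerSemicontinuous f) (μ ν : VMeas Ω d) :
    Measurable (integrand f μ ν) := by
  refine hf.measurable.comp ?_
  exact (continuous_inclusion subset_closure).measurable.prodMk
    ((measurable_ratio μ ν).prodMk ((measurable_direction μ).prodMk (measurable_direction ν)))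

/-- The integral defining the functional exists. -/
lemma integrable_integrand (hf : LowerSemicontinuous f) (hb : ∃ C, ∀ p, |f p| ≤ C)
    (μ ν : VMeas Ω d) : Integrable (integrand f μ ν) (μ.variation + ν.variation) := by
  obtain ⟨C, hC⟩ := hb
  exact Integrable.of_bound (measurable_integrand hf μ ν).aestronglyMeasurable C
    (ae_of_all _ fun x => hC _)

/-- The functional does not depend on the versions of the densities `dμ/d|μ|`, `dν/d|ν|`. -/
lemma functional_eq_of_density
    (h0 : ∀ (x : Ω) (ξ ζ ξ' ζ' : USphere d), f (toClosure x, 0, ξ, ζ) = f (toClosure x, 0, ξ', ζ'))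
    (h1 : ∀ (x : Ω) (ξ ζ ξ' ζ' : USphere d), f (toClosure x, 1, ξ, ζ) = f (toClosure x, 1, ξ', ζ'))
    {μ ν : VMeas Ω d} {a b : Ω → USphere d} (ha : Measurable a) (hb : Measurable b)
    (hμ : μ.variation.withDensityᵥ (fun x => (a x : Vec d)) = μ)
    (hν : ν.variation.withDensityᵥ (fun x => (b x : Vec d)) = ν) :
    functional f μ ν =
      ∫ x, f (toClosure x, ratio μ ν x, a x, b x) ∂(μ.variation + ν.variation) := by
  refine integral_congr_ae ?_
  filter_upwards [ratio_eq_zero_or_ae_eq (ν := ν) ha hμ, ratio_eq_one_or_ae_eq (μ := μ) hb hν]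
    with x hx hy
  rw [integrand]
  rcases hx with hx | hx
  · have : ratio μ ν x = 0 := Subtype.ext hx
    rw [this]; exact h0 _ _ _ _ _
  rcases hy with hy | hy
  · have : ratio μ ν x = 1 := Subtype.ext hy
    rw [this]; exact h1 _ _ _ _ _
  rw [hx, hy]

end WellDefined

end TwoMeasures

end

/-! This is a Young-measure argument. Push `|μ_k| + |ν_k|` forward to the compact space `closure Ω ×
[0,1] × S × S` by the graph of ratio and directions. The functional is then the integral of `f`
against the image measure. If the liminf were too small, bounded masses would give a weak limit `Γ`
along an ultrafilter on which the functionals stay below some `a < F(μ,ν)`, and semicontinuity would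
give `∫ f dΓ ≤ a` (`exists_weak_limit`).

It remains to compare `Γ` with `(μ,ν)`. Weighting by `τ` recovers `|μ_k|`, so `τΓ` with direction
`ξ` represents `μ`; by strict convergence it has no more mass than `|μ|`. Equality in Cauchy–Schwarz
then forces `ξ` to be the direction of `μ` and `|μ|` to be the marginal (`polar_rigidity`). The
weight `1 - τ` does the same for `ν`. Hence `Γ` has marginal `|μ| + |ν|`, does not charge the
boundary, and is undetermined only in `τ`, whose conditional mean is the ratio of `μ` and `ν`.
Jensen's inequality in `τ` yields `F(μ,ν) ≤ ∫ f dΓ` (`functional_le_integral_of_weak_limit`). -/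

noncomputable section

namespace TwoMeasures

/-! ### Weak limits and lower semicontinuous integrands -/

/-- A bounded lower semicontinuous function on a metric space is the pointwise limit of a sequence
of continuous functions that lie below it and obey the same bound. -/
lemma _root_.LowerSemicontinuous.exists_seq_continuous_tendsto {K : Type*} [PseudoMetricSpace K]
    {f : K → ℝ} (hf : LowerSemicontinuous f) {C : ℝ} (hC : ∀ z, |f z| ≤ C) :
    ∃ g : ℕ → K → ℝ, (∀ j, Continuous (g j)) ∧ (∀ j z, g j z ≤ f z) ∧ (∀ j z, |g j z| ≤ C) ∧
      ∀ z, Tendsto (fun j => g j z) atTop (𝓝 (f z)) := by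
  -- The approximants are the inf-convolutions of `f` with `j * dist`; a lower bound is needed for
  -- the real infimum to be meaningful.
  have hbdd : ∀ (j : ℕ) (z : K), BddBelow (range fun w => f w + j * dist z w) := by
    intro j z
    refine ⟨-C, ?_⟩
    rintro _ ⟨w, rfl⟩
    have := (abs_le.1 (hC w)).1
    have : 0 ≤ (j : ℝ) * dist z w := by positivity
    dsimp only
    linarith
  have hle : ∀ (j : ℕ) (z : K), (⨅ w, f w + j * dist z w) ≤ f z := by
    intro j z
    simpa using ciInf_le (hbdd j z) z
  have hge : ∀ (j : ℕ) (z : K), -C ≤ ⨅ w, f w + j * dist z w := by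
    intro j z
    have : Nonempty K := ⟨z⟩
    refine le_ciInf fun w => ?_
    have := (abs_le.1 (hC w)).1
    have : 0 ≤ (j : ℝ) * dist z w := by positivity
    linarith
  refine ⟨fun j z => ⨅ w, f w + j * dist z w, fun j => ?_, hle, fun j z => ?_, fun z => ?_⟩
  · refine (LipschitzWith.of_le_add_mul (j : NNReal) fun x y => ?_).continuous
    have : Nonempty K := ⟨x⟩
    rw [← sub_le_iff_le_add]
    refine le_ciInf fun w => ?_
    have h1 := ciInf_le (hbdd j x) w
    have h2 : (j : ℝ) * dist x w ≤ j * (dist x y + dist y w) := by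
      gcongr
      exact dist_triangle x y w
    simp only [NNReal.coe_natCast]
    linarith
  · exact abs_le.2 ⟨hge j z, (hle j z).trans (abs_le.1 (hC z)).2⟩
  · rw [tendsto_order]
    refine ⟨fun a ha => ?_, fun a ha => Eventually.of_forall fun j => (hle j z).trans_lt ha⟩
    obtain ⟨b, hab, hb⟩ := exists_between ha
    obtain ⟨r, hr, hball⟩ := Metric.eventually_nhds_iff.1 (hf z b hb)
    -- Outside the ball of radius `r` the penalty `j * r ≥ b + C` compensates the worst value `-C`
    -- of `f`.
    obtain ⟨N, hN⟩ := exists_nat_ge ((b + C) / r)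
    filter_upwards [eventually_ge_atTop N] with j hj
    refine hab.trans_le ?_
    have : Nonempty K := ⟨z⟩
    refine le_ciInf fun w => ?_
    rcases lt_or_ge (dist w z) r with h | h
    · have := hball h
      have : 0 ≤ (j : ℝ) * dist z w := by positivity
      linarith
    · have h1 : (b + C) ≤ N * r := (div_le_iff₀ hr).1 hN
      have h2 : (N : ℝ) * r ≤ j * dist z w := by
        rw [dist_comm z w]
        gcongr
      have := (abs_le.1 (hC w)).1
      linarith

/-- A family of finite measures on a compact metric space with bounded masses converges weakly along
every ultrafilter, and upper bounds for the integrals of a lower semicontinuous function pass to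
the limit. -/
lemma exists_weak_limit {K : Type*} [MetricSpace K] [CompactSpace K] [MeasurableSpace K]
    [BorelSpace K] {κ : Type*} (U : Ultrafilter κ) (m : κ → Measure K) [∀ k, IsFiniteMeasure (m k)]
    {M : ℝ≥0∞} (hM : M ≠ ∞) (hm : ∀ᶠ k in U, m k univ ≤ M) {f : K → ℝ}
    (hf : LowerSemicontinuous f) {C : ℝ} (hC : ∀ z, |f z| ≤ C) {a : ℝ}
    (ha : ∀ᶠ k in U, ∫ z, f z ∂(m k) ≤ a) :
    ∃ Γ : Measure K, IsFiniteMeasure Γ ∧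
      (∀ g : K → ℝ, Continuous g → Tendsto (fun k => ∫ z, g z ∂(m k)) U (𝓝 (∫ z, g z ∂Γ))) ∧
      ∫ z, f z ∂Γ ≤ a := by
  let m' : κ → FiniteMeasure K := fun k => ⟨m k, inferInstance⟩
  obtain ⟨Γ, -, hΓ⟩ := (isCompact_setOfPred_finiteMeasure_le_of_compactSpace K
    M.toNNReal).ultrafilter_le_nhds' (U.map m') (by
      rw [Ultrafilter.mem_map]
      filter_upwards [hm] with k hk
      exact ENNReal.toNNReal_mono hM hk)
  have hlim : ∀ g : K → ℝ, Continuous g →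
      Tendsto (fun k => ∫ z, g z ∂(m k)) U (𝓝 (∫ z, g z ∂(Γ : Measure K))) := fun g hg =>
    FiniteMeasure.tendsto_iff_forall_integral_tendsto.1 (show Tendsto m' U (𝓝 Γ) from hΓ)
      (BoundedContinuousFunction.mkOfCompact ⟨g, hg⟩)
  refine ⟨Γ, inferInstance, hlim, ?_⟩
  -- Weak convergence sees only continuous functions: bound each approximant from below in the limit
  -- measure, then let `j → ∞` by dominated convergence.
  obtain ⟨g, hgc, hgf, hgC, hgt⟩ := hf.exists_seq_continuous_tendsto hC
  have h1 : ∀ j, ∫ z, g j z ∂(Γ : Measure K) ≤ a := fun j => by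
    refine le_of_tendsto (hlim _ (hgc j)) ?_
    filter_upwards [ha] with k hk
    refine le_trans (integral_mono ?_ ?_ (hgf j)) hk
    · exact Integrable.of_bound (hgc j).aestronglyMeasurable C (ae_of_all _ (hgC j))
    · exact Integrable.of_bound hf.measurable.aestronglyMeasurable C (ae_of_all _ hC)
  refine le_of_tendsto' (tendsto_integral_of_dominated_convergence (fun _ => C)
    (fun j => (hgc j).aestronglyMeasurable) (integrable_const C)
    (fun j => ae_of_all _ (hgC j)) (ae_of_all _ hgt)) h1

/-! ### Jensen's inequality in the ratio variable -/

/-- Jensen's inequality on the unit interval for lower semicontinuous convex functions. -/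
lemma map_integral_le_of_lowerSemicontinuous (κ : Measure (Icc (0 : ℝ) 1)) [IsProbabilityMeasure κ]
    {h : Icc (0 : ℝ) 1 → ℝ} (hh : LowerSemicontinuous h) {C : ℝ} (hC : ∀ t, |h t| ≤ C)
    (hconv : ConvexOn ℝ (Icc (0 : ℝ) 1) (IccExtend zero_le_one h)) {t : Icc (0 : ℝ) 1}
    (ht : (t : ℝ) = ∫ s, (s : ℝ) ∂κ) : h t ≤ ∫ s, h s ∂κ := by
  have hlsc : LowerSemicontinuous (IccExtend zero_le_one h) :=
    hh.comp continuous_projIcc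
  have hcl : IsClosed {p : ℝ × ℝ | p.1 ∈ Icc (0 : ℝ) 1 ∧ IccExtend zero_le_one h p.1 ≤ p.2} :=
    (isClosed_Icc.preimage continuous_fst).inter hlsc.isClosed_epigraph
  have hi1 : Integrable (fun s : Icc (0 : ℝ) 1 => (s : ℝ)) κ :=
    Integrable.of_bound (by fun_prop) 1 (ae_of_all _ fun s => by
      rw [Real.norm_of_nonneg s.2.1]; exact s.2.2)
  have hi2 : Integrable h κ :=
    Integrable.of_bound hh.measurable.aestronglyMeasurable C (ae_of_all _ hC)
  -- The mean of the points `(s, h s)` stays in the epigraph, which is convex and, by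
  -- semicontinuity, closed.
  have hmem := hconv.convex_epigraph.integral_mem (μ := κ) (f := fun s => ((s : ℝ), h s)) hcl
    (ae_of_all _ fun s => ⟨s.2, by simp⟩) (hi1.prodMk hi2)
  rw [integral_pair hi1 hi2, ← ht] at hmem
  simpa using hmem.2

/-- Jensen's inequality for the disintegration of a measure on `X × [0,1]`. -/
lemma integral_barycenter_le {X : Type*} [MeasurableSpace X] (ρ : Measure (X × Icc (0 : ℝ) 1))
    [IsFiniteMeasure ρ] {θ : X → Icc (0 : ℝ) 1} (hθ : Measurable θ)
    (hbar : ∀ s, MeasurableSet s →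
      ∫ p in Prod.fst ⁻¹' s, (p.2 : ℝ) ∂ρ = ∫ x in s, (θ x : ℝ) ∂ρ.fst)
    {h : X × Icc (0 : ℝ) 1 → ℝ} (hm : Measurable h) {C : ℝ} (hC : ∀ p, |h p| ≤ C)
    (hlsc : ∀ x, LowerSemicontinuous fun t => h (x, t))
    (hconv : ∀ x, ConvexOn ℝ (Icc (0 : ℝ) 1) (IccExtend zero_le_one fun t => h (x, t))) :
    ∫ x, h (x, θ x) ∂ρ.fst ≤ ∫ p, h p ∂ρ := by
  have hi : Integrable h ρ := Integrable.of_bound hm.aestronglyMeasurable C (ae_of_all _ hC)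
  have hiτ : Integrable (fun p : X × Icc (0 : ℝ) 1 => (p.2 : ℝ)) ρ :=
    Integrable.of_bound (by fun_prop) 1 (ae_of_all _ fun s => by
      rw [Real.norm_of_nonneg s.2.2.1]; exact s.2.2.2)
  have hθi : Integrable (fun x => (θ x : ℝ)) ρ.fst :=
    Integrable.of_bound (by fun_prop) 1 (ae_of_all _ fun s => by
      rw [Real.norm_of_nonneg (θ s).2.1]; exact (θ s).2.2)
  -- The barycenter condition, tested on all measurable sets, says that almost every conditional
  -- measure has mean `θ x`; Jensen then applies fiber by fiber.
  have hb : (fun x => ∫ t, (t : ℝ) ∂(ρ.condKernel x)) =ᵐ[ρ.fst] fun x => (θ x : ℝ) := by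
    refine Integrable.ae_eq_of_forall_setIntegral_eq _ _ hiτ.integral_condKernel hθi
      fun s hs _ => ?_
    rw [← hbar s hs, ← Set.prod_univ, ← Measure.setIntegral_condKernel_univ_right hs
      hiτ.integrableOn]
  rw [← Measure.integral_condKernel hi]
  refine integral_mono_ae (Integrable.of_bound
    (hm.comp (measurable_id.prodMk hθ)).aestronglyMeasurable C (ae_of_all _ fun x => hC _)) hi.integral_condKernel ?_
  filter_upwards [hb] with x hx
  exact map_integral_le_of_lowerSemicontinuous _ (hlsc x) (fun t => hC _) (hconv x) hx.symm

/-! ### Polar decompositions and their rigidity -/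

section Rigidity

variable {X : Type*} [MeasurableSpace X] {d : ℕ} [NeZero d]

lemma measurable_coe_direction (μ : VMeas X d) : Measurable fun x => (direction μ x : Vec d) :=
  measurable_subtype_coe.comp (measurable_direction μ)

lemma integrable_direction (μ : VMeas X d) :
    Integrable (fun x => (direction μ x : Vec d)) μ.variation :=
  Integrable.of_bound (measurable_coe_direction μ).aestronglyMeasurable 1
    (ae_of_all _ fun x => by simp)

lemma integrable_smul_direction (μ : VMeas X d) {ψ : X → ℝ} (hψ : Integrable ψ μ.variation) :
    Integrable (fun x => ψ x • (direction μ x : Vec d)) μ.variation :=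
  hψ.smul_bdd 1 (measurable_coe_direction μ).aestronglyMeasurable
    (ae_of_all _ fun x => by simp)

/-- The integral against a vector measure in terms of its polar decomposition. -/
lemma integral_eq_integral_smul_direction (μ : VMeas X d) {ψ : X → ℝ}
    (hψ : Integrable ψ μ.variation) :
    ∫ᵛ x, ψ x ∂•μ = ∫ x, ψ x • (direction μ x : Vec d) ∂μ.variation := by
  refine Integrable.induction (μ := μ.variation)
    (fun ψ => ∫ᵛ x, ψ x ∂•μ = ∫ x, ψ x • (direction μ x : Vec d) ∂μ.variation) ?_ ?_ ?_ ?_ hψ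
  · intro c s hs _
    rw [VectorMeasure.integral_indicator hs, VectorMeasure.integral_const]
    have h1 : (fun x => s.indicator (fun _ => c) x • (direction μ x : Vec d)) =
        s.indicator fun x => c • (direction μ x : Vec d) := by
      ext1 x
      by_cases hx : x ∈ s <;> simp [hx]
    rw [h1, integral_indicator hs, integral_smul,
      ← withDensityᵥ_apply (integrable_direction μ) hs, withDensity_direction]
    simp [VectorMeasure.restrict_apply _ hs]
  · intro f g _ hf hg hf' hg'
    rw [VectorMeasure.integral_add hf hg, hf', hg', ← integral_add
      (integrable_smul_direction μ hf) (integrable_smul_direction μ hg)]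
    simp [add_smul]
  · refine isClosed_eq (by fun_prop) ?_
    rw [continuous_iff_continuousAt]
    intro f
    refine tendsto_integral_of_L1 _ ?_ ?_ ?_
    · exact (integrable_smul_direction μ (L1.integrable_coeFn f)).aestronglyMeasurable
    · exact Eventually.of_forall fun g => integrable_smul_direction μ (L1.integrable_coeFn g)
    -- The direction has norm one, so multiplication by it preserves `L¹` distances.
    · have h1 : Tendsto (fun g : X →₁[μ.variation] ℝ => edist g f) (𝓝 f) (𝓝 0) := by
        have : Continuous fun g : X →₁[μ.variation] ℝ => edist g f := by fun_prop
        simpa using this.tendsto f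
      refine h1.congr fun g => ?_
      rw [L1.edist_def]
      refine lintegral_congr fun x => ?_
      rw [← sub_smul, enorm_smul, edist_eq_enorm_sub]
      simp [← ofReal_norm]
  · intro f g hfg hf h
    rw [← VectorMeasure.integral_congr_ae hfg, h]
    refine integral_congr_ae ?_
    filter_upwards [hfg] with x hx
    rw [hx]

lemma integral_apply_eq (μ : VMeas X d) {ψ : X → ℝ} (hψ : Integrable ψ μ.variation) (i : Fin d) :
    (∫ᵛ x, ψ x ∂•μ) i = ∫ x, ψ x * (direction μ x : Vec d) i ∂μ.variation := by
  rw [integral_eq_integral_smul_direction μ hψ]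
  exact ((EuclideanSpace.proj i : Vec d →L[ℝ] ℝ).integral_comp_comm
    (integrable_smul_direction μ hψ)).symm

variable [MetricSpace X] [BorelSpace X] [LocallyCompactSpace X] [SecondCountableTopology X]

/-- If a measure `σ` on `Z`, with positions `p` and directions `v`, represents the vector measure `μ`
and its mass does not exceed the total variation of `μ`, then it is the polar decomposition
of `μ`. -/
lemma polar_rigidity {Z : Type*} [MeasurableSpace Z] (μ : VMeas X d) (σ : Measure Z)
    [IsFiniteMeasure σ] {p : Z → X} (hp : Measurable p) {v : Z → USphere d} (hv : Measurable v)
    (h : ∀ ψ : X → ℝ, Continuous ψ → HasCompactSupport ψ → ∀ i,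
      ∫ z, ψ (p z) * (v z : Vec d) i ∂σ = (∫ᵛ x, ψ x ∂•μ) i)
    (hmass : σ univ ≤ μ.variation univ) :
    (∀ᵐ z ∂σ, v z = direction μ (p z)) ∧ σ.map p = μ.variation := by
  -- Approximation in `L¹(m)` controls the errors on both sides of the identity at once.
  set m : Measure X := σ.map p + μ.variation
  have hvm : Measurable fun z => (v z : Vec d) := measurable_subtype_coe.comp hv
  have hpush : ∀ Φ : X → Vec d, Measurable Φ → Integrable Φ m →
      Integrable (fun z => Φ (p z)) σ := fun Φ hΦ hi =>
    (integrable_map_measure hΦ.aestronglyMeasurable hp.aemeasurable).1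
      (hi.mono_measure (Measure.le_add_right le_rfl))
  have hi1 : ∀ Φ : X → Vec d, Measurable Φ → Integrable Φ m →
      Integrable (fun z => inner ℝ (Φ (p z)) (v z : Vec d)) σ := fun Φ hΦ hi =>
    (hpush Φ hΦ hi).mono ((hΦ.comp hp).inner hvm).aestronglyMeasurable (ae_of_all _ fun z => by
      simpa using norm_inner_le_norm (𝕜 := ℝ) (Φ (p z)) (v z : Vec d))
  have hi2 : ∀ Φ : X → Vec d, Measurable Φ → Integrable Φ m →
      Integrable (fun x => inner ℝ (Φ x) (direction μ x : Vec d)) μ.variation := fun Φ hΦ hi =>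
    (hi.mono_measure (Measure.le_add_left le_rfl)).mono
      (hΦ.inner (measurable_coe_direction μ)).aestronglyMeasurable (ae_of_all _ fun z => by
      simpa using norm_inner_le_norm (𝕜 := ℝ) (Φ z) (direction μ z : Vec d))
  have hcs : ∀ Φ : X → Vec d, Continuous Φ → HasCompactSupport Φ →
      ∫ z, inner ℝ (Φ (p z)) (v z : Vec d) ∂σ =
        ∫ x, inner ℝ (Φ x) (direction μ x : Vec d) ∂μ.variation := by
    intro Φ hΦ hs
    have hc : ∀ i, Continuous fun x => Φ x i := fun i => by fun_prop
    have hcomp : ∀ i, HasCompactSupport fun x => Φ x i := fun i =>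
      hs.comp_left (g := fun y : Vec d => y i) rfl
    have hint : ∀ i (τ : Measure X) [IsFiniteMeasure τ], Integrable (fun x => Φ x i) τ :=
      fun i τ _ => (hc i).integrable_of_hasCompactSupport (hcomp i)
    simp only [PiLp.inner_apply, RCLike.inner_apply, conj_trivial]
    have hb : ∀ (y : USphere d) (i : Fin d), ‖(y : Vec d) i‖ ≤ 1 := fun y i =>
      (PiLp.norm_apply_le (y : Vec d) i).trans (by simp)
    rw [integral_finsetSum _ fun i _ => ?_, integral_finsetSum _ fun i _ => ?_]
    · refine Finset.sum_congr rfl fun i _ => ?_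
      have h1 := h _ (hc i) (hcomp i) i
      rw [integral_apply_eq μ (hint i _)] at h1
      simpa only [mul_comm] using h1
    · exact (hint i _).bdd_mul (c := 1) 
        ((EuclideanSpace.proj i : Vec d →L[ℝ] ℝ).measurable.comp
          (measurable_coe_direction μ)).aestronglyMeasurable (ae_of_all _ fun x => hb _ i)
    · exact ((integrable_map_measure (hc i).aestronglyMeasurable hp.aemeasurable).1
        (hint i (σ.map p))).bdd_mul (c := 1)
        ((EuclideanSpace.proj i : Vec d →L[ℝ] ℝ).measurable.comp hvm).aestronglyMeasurable
        (ae_of_all _ fun x => hb _ i)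
  have hall : ∀ Φ : X → Vec d, Measurable Φ → Integrable Φ m →
      ∫ z, inner ℝ (Φ (p z)) (v z : Vec d) ∂σ =
        ∫ x, inner ℝ (Φ x) (direction μ x : Vec d) ∂μ.variation := by
    intro Φ hΦ hi
    refine eq_of_forall_dist_le fun ε hε => ?_
    rw [Real.dist_eq]
    obtain ⟨Ψ, hΨs, hΨ, hΨc, hΨi⟩ := hi.exists_hasCompactSupport_integral_sub_le hε
    have e1 : ∫ z, inner ℝ (Φ (p z)) (v z : Vec d) ∂σ - ∫ z, inner ℝ (Ψ (p z)) (v z : Vec d) ∂σ =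
        ∫ z, inner ℝ ((Φ - Ψ) (p z)) (v z : Vec d) ∂σ := by
      rw [← integral_sub (hi1 Φ hΦ hi) (hi1 Ψ hΨc.measurable hΨi)]
      simp [inner_sub_left]
    have e2 : ∫ x, inner ℝ (Φ x) (direction μ x : Vec d) ∂μ.variation -
        ∫ x, inner ℝ (Ψ x) (direction μ x : Vec d) ∂μ.variation =
        ∫ x, inner ℝ ((Φ - Ψ) x) (direction μ x : Vec d) ∂μ.variation := by
      rw [← integral_sub (hi2 Φ hΦ hi) (hi2 Ψ hΨc.measurable hΨi)]
      simp [inner_sub_left]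
    have hdm : Measurable (Φ - Ψ) := hΦ.sub hΨc.measurable
    have hdi : Integrable (Φ - Ψ) m := hi.sub hΨi
    have b1 : |∫ z, inner ℝ ((Φ - Ψ) (p z)) (v z : Vec d) ∂σ| ≤ ∫ x, ‖(Φ - Ψ) x‖ ∂(σ.map p) := by
      rw [integral_map hp.aemeasurable hdm.norm.aestronglyMeasurable, ← Real.norm_eq_abs]
      refine norm_integral_le_of_norm_le (hpush _ hdm hdi).norm (ae_of_all _ fun z => ?_)
      simpa using norm_inner_le_norm (𝕜 := ℝ) ((Φ - Ψ) (p z)) (v z : Vec d)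
    have b2 : |∫ x, inner ℝ ((Φ - Ψ) x) (direction μ x : Vec d) ∂μ.variation| ≤
        ∫ x, ‖(Φ - Ψ) x‖ ∂μ.variation := by
      rw [← Real.norm_eq_abs]
      refine norm_integral_le_of_norm_le
        (hdi.mono_measure (Measure.le_add_left le_rfl)).norm (ae_of_all _ fun z => ?_)
      simpa using norm_inner_le_norm (𝕜 := ℝ) ((Φ - Ψ) z) (direction μ z : Vec d)
    have b3 : ∫ x, ‖(Φ - Ψ) x‖ ∂m =
        ∫ x, ‖(Φ - Ψ) x‖ ∂(σ.map p) + ∫ x, ‖(Φ - Ψ) x‖ ∂μ.variation :=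
      integral_add_measure (hdi.mono_measure (Measure.le_add_right le_rfl)).norm
        (hdi.mono_measure (Measure.le_add_left le_rfl)).norm
    have b4 : ∫ x, ‖(Φ - Ψ) x‖ ∂m ≤ ε := hΨ
    have e3 := hcs Ψ hΨc hΨs
    rw [← e1] at b1
    rw [← e2] at b2
    rw [abs_le] at *
    constructor <;> linarith [b1.1, b1.2, b2.1, b2.2]
  have hdir : Integrable (fun x => (direction μ x : Vec d)) m :=
    Integrable.of_bound (measurable_coe_direction μ).aestronglyMeasurable 1
      (ae_of_all _ fun x => by simp)
  -- The direction of `μ` is itself the test field, which is why `hall` had to reach merely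
  -- measurable fields; its inner product with itself is one.
  have hind : ∀ s, MeasurableSet s →
      ∫ z in p ⁻¹' s, inner ℝ (direction μ (p z) : Vec d) (v z : Vec d) ∂σ =
        μ.variation.real s := by
    intro s hs
    have h1 := hall (s.indicator fun x => (direction μ x : Vec d))
      ((measurable_coe_direction μ).indicator hs) (hdir.indicator hs)
    rw [← integral_indicator (hp hs), ← integral_indicator_one hs]
    refine Eq.trans (integral_congr_ae (ae_of_all _ fun z => ?_))
      (h1.trans (integral_congr_ae (ae_of_all _ fun x => ?_)))
    · by_cases hz : p z ∈ s <;> simp [hz, indicator]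
    · by_cases hx : x ∈ s <;> simp [hx]
  have hle : ∀ z, inner ℝ (direction μ (p z) : Vec d) (v z : Vec d) ≤ 1 := fun z => by
    simpa using real_inner_le_norm (direction μ (p z) : Vec d) (v z : Vec d)
  -- The inner product is at most one, yet its integral is `|μ|(X) ≥ σ(Z)`; hence it equals one
  -- almost everywhere.
  have hae : ∀ᵐ z ∂σ, inner ℝ (direction μ (p z) : Vec d) (v z : Vec d) = 1 := by
    have hii := hi1 _ (measurable_coe_direction μ) hdir
    have h0 : (fun z => 1 - inner ℝ (direction μ (p z) : Vec d) (v z : Vec d)) =ᵐ[σ] 0 := by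
      rw [← integral_eq_zero_iff_of_nonneg (fun z => sub_nonneg.2 (hle z))
        ((integrable_const 1).sub hii)]
      refine le_antisymm ?_ (integral_nonneg fun z => sub_nonneg.2 (hle z))
      rw [integral_sub (integrable_const 1) hii]
      have h2 := hind univ MeasurableSet.univ
      rw [preimage_univ, setIntegral_univ] at h2
      rw [h2, integral_const, smul_eq_mul, mul_one, sub_nonpos]
      exact ENNReal.toReal_mono (measure_ne_top _ _) hmass
    filter_upwards [h0] with z hz
    exact (sub_eq_zero.1 hz).symm
  constructor
  · filter_upwards [hae] with z hz
    exact Subtype.ext ((inner_eq_one_iff_of_norm_eq_one (by simp) (by simp)).1 hz).symm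
  · ext s hs
    rw [Measure.map_apply hp hs, ← measureReal_eq_measureReal_iff, ← hind s hs]
    have : ∫ z in p ⁻¹' s, inner ℝ (direction μ (p z) : Vec d) (v z : Vec d) ∂σ =
        ∫ z in p ⁻¹' s, (1 : ℝ) ∂σ := by
      refine integral_congr_ae ?_
      filter_upwards [ae_restrict_of_ae hae] with z hz using hz
    rw [this]
    simp

end Rigidity

/-- The weights `τ` and `1 - τ` sum to one, and the finite measure `|μ|` can be cancelled. This lets
`ν` be handled exactly like `μ`, with weight `1 - τ`. -/
lemma withDensity_one_sub_ratio {X : Type*} [MeasurableSpace X] {d : ℕ} (μ ν : VMeas X d) :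
    (μ.variation + ν.variation).withDensity (fun x => ENNReal.ofReal (1 - ratio μ ν x)) =
      ν.variation := by
  have hm : Measurable fun x => (ratio μ ν x : ℝ) :=
    measurable_subtype_coe.comp (measurable_ratio μ ν)
  have h1 : (μ.variation + ν.variation).withDensity (fun x => ENNReal.ofReal (ratio μ ν x)) +
      (μ.variation + ν.variation).withDensity (fun x => ENNReal.ofReal (1 - ratio μ ν x)) =
      μ.variation + ν.variation := by
    rw [← withDensity_add_left hm.ennreal_ofReal]
    conv_rhs => rw [← withDensity_one (μ := μ.variation + ν.variation)]
    congr 1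
    ext1 x
    rw [Pi.add_apply, ← ENNReal.ofReal_add (ratio μ ν x).2.1 (sub_nonneg.2 (ratio μ ν x).2.2)]
    simp
  rw [withDensity_ratio] at h1
  ext s hs
  have h2 := congrArg (fun τ : Measure X => τ s) h1
  simp only [Measure.add_apply] at h2
  exact (ENNReal.add_right_inj (measure_ne_top _ _)).1 h2

/-! ### Weak limits of the graph measures -/

section Limit

variable {n d : ℕ} [NeZero d] {Ω : Set (EuclideanSpace ℝ (Fin n))}

lemma isOpenEmbedding_toClosure (hΩ : IsOpen Ω) :
    IsOpenEmbedding (toClosure : Ω → closure Ω) := by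
  refine ⟨IsEmbedding.inclusion subset_closure, ?_⟩
  have : range (toClosure : Ω → closure Ω) = Subtype.val ⁻¹' Ω := by
    ext y
    exact ⟨fun ⟨x, hx⟩ => hx ▸ x.2, fun hy => ⟨⟨y, hy⟩, rfl⟩⟩
  rw [this]
  exact hΩ.preimage continuous_subtype_val

/-- Weak limits live over the compact closure, vector measures over `Ω`; pulling back along this
embedding discards whatever sits over the boundary. -/
lemma measurableEmbedding_prodMap_toClosure (hΩ : IsOpen Ω) (Y : Type*) [TopologicalSpace Y]
    [SecondCountableTopology Y] [MeasurableSpace Y] [BorelSpace Y] :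
    MeasurableEmbedding (Prod.map toClosure id : Ω × Y → closure Ω × Y) :=
  ((isOpenEmbedding_toClosure hΩ).prodMap IsOpenEmbedding.id).measurableEmbedding

/-- Identification of the weak limit `Γ` of the measures carried by the graphs of `T k`, when the
weight `w` and the direction `u` recover the polar decomposition of a strictly convergent
sequence. -/
lemma polar_decomposition_of_weak_limit (hΩ : IsOpen Ω) {Y : Type*} [TopologicalSpace Y]
    [CompactSpace Y] [SecondCountableTopology Y] [MeasurableSpace Y] [BorelSpace Y]
    {l : Filter ℕ} [l.NeBot] (hl : l ≤ atTop) {μs : ℕ → VMeas Ω d} {μ : VMeas Ω d}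
    (hμ : StrictConverges μs μ) (m : ℕ → Measure Ω) {T : ℕ → Ω → Y} (hT : ∀ k, Measurable (T k))
    {Γ : Measure (closure Ω × Y)} [IsFiniteMeasure Γ]
    (hΓ : ∀ g : closure Ω × Y → ℝ, Continuous g →
      Tendsto (fun k => ∫ z, g z ∂((m k).map fun x => (toClosure x, T k x))) l (𝓝 (∫ z, g z ∂Γ)))
    {w : Y → ℝ} (hw : Continuous w) (hw0 : ∀ y, 0 ≤ w y) {u : Y → USphere d} (hu : Continuous u)
    (hdens : ∀ k, (m k).withDensity (fun x => ENNReal.ofReal (w (T k x))) = (μs k).variation)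
    (hdir : ∀ k x, u (T k x) = direction (μs k) x) :
    (∀ᵐ z ∂Γ.comap (Prod.map toClosure id : Ω × Y → closure Ω × Y),
        w z.2 = 0 ∨ u z.2 = direction μ z.1) ∧
      ((Γ.comap (Prod.map toClosure id : Ω × Y → closure Ω × Y)).withDensity
        fun z => ENNReal.ofReal (w z.2)).map Prod.fst = μ.variation ∧
      ∫⁻ z, ENNReal.ofReal (w z.2) ∂Γ = μ.variation univ := by
  set ι : Ω × Y → closure Ω × Y := Prod.map toClosure id with hιdef
  have hι : MeasurableEmbedding ι := measurableEmbedding_prodMap_toClosure hΩ Y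
  have hwm : Measurable fun z : Ω × Y => ENNReal.ofReal (w z.2) :=
    (hw.measurable.comp measurable_snd).ennreal_ofReal
  have hTm : ∀ k, Measurable fun x : Ω => (toClosure x, T k x) := fun k =>
    (continuous_inclusion subset_closure).measurable.prodMk (hT k)
  have hwT : ∀ k, Measurable fun x => ENNReal.ofReal (w (T k x)) := fun k =>
    (hw.measurable.comp (hT k)).ennreal_ofReal
  have hkey : ∀ k (φ : Ω → ℝ), ∫ x, w (T k x) * φ x ∂(m k) = ∫ x, φ x ∂(μs k).variation := by
    intro k φ
    rw [← hdens k, integral_withDensity_eq_integral_toReal_smul (hwT k)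
      (ae_of_all _ fun x => ENNReal.ofReal_lt_top)]
    simp [ENNReal.toReal_ofReal (hw0 _)]
  obtain ⟨W, hW⟩ : ∃ W, ∀ y, ‖w y‖ ≤ W := by
    obtain ⟨W, hW⟩ := isCompact_univ.exists_bound_of_continuousOn hw.continuousOn
    exact ⟨W, fun y => hW y (mem_univ y)⟩
  have hwi : Integrable (fun z : closure Ω × Y => w z.2) Γ :=
    Integrable.of_bound (hw.comp continuous_snd).aestronglyMeasurable W (ae_of_all _ fun z => hW _)
  -- Convergence of the total masses enters here: `w` is an admissible test function on the compact
  -- product.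
  have htot : ∫⁻ z, ENNReal.ofReal (w z.2) ∂Γ = μ.variation univ := by
    rw [← ofReal_integral_eq_lintegral_ofReal hwi (ae_of_all _ fun z => hw0 _)]
    have h1 := hΓ (fun z => w z.2) (hw.comp continuous_snd)
    have h2 : Tendsto (fun k => ((μs k).variation univ).toReal) l
        (𝓝 (μ.variation univ).toReal) :=
      ((ENNReal.tendsto_toReal (measure_ne_top _ _)).comp hμ.2).mono_left hl
    have h3 : ∀ k, ∫ z, w z.2 ∂((m k).map fun x => (toClosure x, T k x)) =
        ((μs k).variation univ).toReal := by
      intro k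
      rw [integral_map (f := fun z : closure Ω × Y => w z.2) (hTm k).aemeasurable
        (hw.comp continuous_snd).aestronglyMeasurable]
      have := hkey k fun _ => 1
      simpa [Measure.real] using this
    simp only [h3] at h1
    rw [tendsto_nhds_unique h1 h2, ENNReal.ofReal_toReal (measure_ne_top _ _)]
  have hmap : (Γ.comap ι).map ι = Γ.restrict (range ι) := hι.map_comap Γ
  set σ := (Γ.comap ι).withDensity fun z => ENNReal.ofReal (w z.2) with hσ
  -- Discarding the boundary can only lose mass, and rigidity needs only this inequality.
  have hmass : σ univ ≤ μ.variation univ := by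
    rw [hσ, withDensity_apply _ MeasurableSet.univ, Measure.restrict_univ, ← htot]
    calc ∫⁻ z, ENNReal.ofReal (w z.2) ∂Γ.comap ι
        = ∫⁻ z, ENNReal.ofReal (w z.2) ∂(Γ.comap ι).map ι := by
          rw [hι.lintegral_map]; rfl
      _ ≤ ∫⁻ z, ENNReal.ofReal (w z.2) ∂Γ := by
        rw [hmap]
        exact setLIntegral_le_lintegral _ _
  have : IsFiniteMeasure σ := ⟨hmass.trans_lt (measure_lt_top _ _)⟩
  have : LocallyCompactSpace Ω := hΩ.locallyCompactSpace
  have hrep : ∀ ψ : Ω → ℝ, Continuous ψ → HasCompactSupport ψ → ∀ i,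
      ∫ z, ψ z.1 * (u z.2 : Vec d) i ∂σ = (∫ᵛ x, ψ x ∂•μ) i := by
    intro ψ hψ hs i
    -- Compact support in the open set `Ω` makes the extension by zero continuous, and the boundary
    -- contributes nothing to the integral.
    set ψ' : closure Ω → ℝ := fun y => Function.extend Subtype.val ψ 0 (y : EuclideanSpace ℝ (Fin n))
    have hψ'c : Continuous ψ' :=
      (hs.continuous_extend_zero hΩ hψ).comp continuous_subtype_val
    have hψ'e : ∀ x, ψ' (toClosure x) = ψ x := fun x =>
      Subtype.val_injective.extend_apply ψ 0 x
    set g : closure Ω × Y → ℝ := fun z => w z.2 * (ψ' z.1 * (u z.2 : Vec d) i) with hg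
    have hui : Continuous fun y => (u y : Vec d) i :=
      (EuclideanSpace.proj i : Vec d →L[ℝ] ℝ).continuous.comp (continuous_subtype_val.comp hu)
    have hgc : Continuous g :=
      (hw.comp continuous_snd).mul ((hψ'c.comp continuous_fst).mul (hui.comp continuous_snd))
    have e1 : ∫ z, ψ z.1 * (u z.2 : Vec d) i ∂σ = ∫ z, g z ∂Γ := by
      rw [hσ, integral_withDensity_eq_integral_toReal_smul hwm
        (ae_of_all _ fun x => ENNReal.ofReal_lt_top)]
      calc _ = ∫ z, g (ι z) ∂Γ.comap ι := by
            refine integral_congr_ae (ae_of_all _ fun z => ?_)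
            simp [hg, hιdef, hψ'e, ENNReal.toReal_ofReal (hw0 _)]
        _ = ∫ z in range ι, g z ∂Γ := by rw [← hι.integral_map, hmap]
        _ = ∫ z, g z ∂Γ := by
            refine setIntegral_eq_integral_of_forall_compl_eq_zero fun z hz => ?_
            have h0 : ψ' z.1 = 0 := by
              refine Function.extend_apply' _ _ _ ?_
              rintro ⟨x, hx⟩
              exact hz ⟨(x, z.2), Prod.ext (Subtype.ext hx) rfl⟩
            simp [hg, h0]
    have e2 : ∀ k, ∫ z, g z ∂((m k).map fun x => (toClosure x, T k x)) =
        (∫ᵛ x, ψ x ∂•(μs k)) i := by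
      intro k
      rw [integral_map (hTm k).aemeasurable hgc.aestronglyMeasurable,
        integral_apply_eq _ (hψ.integrable_of_hasCompactSupport hs), ← hkey k]
      simp only [hg, hψ'e, hdir]
    have h3 := hΓ g hgc
    simp only [e2] at h3
    have h4 := ((EuclideanSpace.proj i : Vec d →L[ℝ] ℝ).continuous.tendsto _).comp
      (hμ.1 ⟨⟨ψ, hψ⟩, hs.is_zero_at_infty⟩)
    rw [e1]
    exact tendsto_nhds_unique h3 (h4.mono_left hl)
  obtain ⟨h1, h2⟩ := polar_rigidity μ σ measurable_fst (v := fun z => u z.2)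
    (hu.measurable.comp measurable_snd) hrep hmass
  refine ⟨?_, h2, htot⟩
  rw [hσ, ae_withDensity_iff hwm] at h1
  filter_upwards [h1] with z hz
  by_cases h0 : w z.2 = 0
  · exact Or.inl h0
  · refine Or.inr (hz ?_)
    simpa using lt_of_le_of_ne (hw0 _) (Ne.symm h0)

/-- The functional is at most the integral of `f` against a weak limit of the measures carried by
the graphs of the ratios and directions of two strictly convergent sequences. -/
lemma functional_le_integral_of_weak_limit (hΩ : IsOpen Ω) {f : Dom Ω d → ℝ}
    (hf : LowerSemicontinuous f) {C : ℝ} (hC : ∀ p, |f p| ≤ C)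
    (hf0 : ∀ (x : Ω) (ξ ζ ξ' ζ' : USphere d),
      f (toClosure x, 0, ξ, ζ) = f (toClosure x, 0, ξ', ζ'))
    (hf1 : ∀ (x : Ω) (ξ ζ ξ' ζ' : USphere d),
      f (toClosure x, 1, ξ, ζ) = f (toClosure x, 1, ξ', ζ'))
    (hconv : ∀ (x : Ω) (ξ ζ : USphere d), ConvexOn ℝ (Icc (0 : ℝ) 1)
      (IccExtend zero_le_one fun τ => f (toClosure x, τ, ξ, ζ)))
    {μs νs : ℕ → VMeas Ω d} {μ ν : VMeas Ω d}
    (hμ : StrictConverges μs μ) (hν : StrictConverges νs ν)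
    {l : Filter ℕ} [l.NeBot] (hl : l ≤ atTop) {Γ : Measure (Dom Ω d)} [IsFiniteMeasure Γ]
    (hΓ : ∀ g : Dom Ω d → ℝ, Continuous g →
      Tendsto (fun k => ∫ z, g z ∂(((μs k).variation + (νs k).variation).map fun x =>
        (toClosure x, ratio (μs k) (νs k) x, direction (μs k) x, direction (νs k) x))) l
        (𝓝 (∫ z, g z ∂Γ))) :
    functional f μ ν ≤ ∫ z, f z ∂Γ := by
  set ι : Ω × Icc (0 : ℝ) 1 × USphere d × USphere d → Dom Ω d := Prod.map toClosure id with hιdef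
  have hι : MeasurableEmbedding ι := measurableEmbedding_prodMap_toClosure hΩ _
  have hT : ∀ k, Measurable fun x =>
      (ratio (μs k) (νs k) x, direction (μs k) x, direction (νs k) x) := fun k =>
    (measurable_ratio _ _).prodMk ((measurable_direction _).prodMk (measurable_direction _))
  obtain ⟨hξ, hmarg1, hmass1⟩ := polar_decomposition_of_weak_limit hΩ hl hμ _ hT hΓ
    (w := fun y => (y.1 : ℝ)) (by fun_prop) (fun y => y.1.2.1)
    (u := fun y => y.2.1) (by fun_prop) (fun k => withDensity_ratio _ _) (fun k x => rfl)
  obtain ⟨hζ, hmarg2, hmass2⟩ := polar_decomposition_of_weak_limit hΩ hl hν _ hT hΓ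
    (w := fun y => 1 - (y.1 : ℝ)) (by fun_prop) (fun y => sub_nonneg.2 y.1.2.2)
    (u := fun y => y.2.2) (by fun_prop) (fun k => withDensity_one_sub_ratio _ _) (fun k x => rfl)
  rw [← hιdef] at hξ hζ hmarg1 hmarg2
  set Γ' := Γ.comap ι with hΓ'
  have hmap : Γ'.map ι = Γ.restrict (range ι) := hι.map_comap Γ
  have hwt : ∀ t : Icc (0 : ℝ) 1, ENNReal.ofReal (t : ℝ) + ENNReal.ofReal (1 - (t : ℝ)) = 1 := by
    intro t
    rw [← ENNReal.ofReal_add t.2.1 (sub_nonneg.2 t.2.2)]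
    simp
  have hτm : Measurable fun z : Ω × Icc (0 : ℝ) 1 × USphere d × USphere d =>
      ENNReal.ofReal (z.2.1 : ℝ) := by fun_prop
  have hmarg : Γ'.map Prod.fst = μ.variation + ν.variation := by
    rw [← hmarg1, ← hmarg2, ← Measure.map_add _ _ measurable_fst, ← withDensity_add_left hτm]
    congr 1
    conv_lhs => rw [← withDensity_one (μ := Γ')]
    congr 1
    ext1 z
    exact (hwt _).symm
  -- Both sides equal `|μ|(Ω) + |ν|(Ω)`: the left by the total weights, the right by the marginal.
  -- So no mass concentrates on the boundary.
  have hΓuniv : Γ univ = Γ (range ι) := by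
    have h1 : Γ' univ = μ.variation univ + ν.variation univ := by
      have := congrArg (fun τ : Measure Ω => τ univ) hmarg
      simpa [Measure.map_apply measurable_fst MeasurableSet.univ] using this
    have h2 : Γ' univ = Γ (range ι) := by rw [hΓ', hι.comap_apply, image_univ]
    rw [← h2, h1, ← hmass1, ← hmass2, ← lintegral_add_left (by fun_prop)]
    simp [hwt]
  have hrange : ∀ᵐ z ∂Γ, z ∈ range ι :=
    (ae_iff_measure_eq hι.measurableSet_range.nullMeasurableSet).2 hΓuniv.symm
  have hint : ∫ z, f z ∂Γ = ∫ z, f (ι z) ∂Γ' := by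
    rw [← hι.integral_map, hmap, Measure.restrict_eq_self_of_ae_mem hrange]
  set h : Ω × Icc (0 : ℝ) 1 → ℝ := fun p => f (toClosure p.1, p.2, direction μ p.1, direction ν p.1)
  have htc : Measurable (toClosure : Ω → closure Ω) :=
    (continuous_inclusion subset_closure).measurable
  have hhm : Measurable h :=
    hf.measurable.comp ((htc.comp measurable_fst).prodMk (measurable_snd.prodMk
      (((measurable_direction μ).comp measurable_fst).prodMk
        ((measurable_direction ν).comp measurable_fst))))
  -- Rigidity identifies `ξ` only where `τ ≠ 0` and `ζ` only where `τ ≠ 1`; at the endpoints `f`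
  -- ignores the directions.
  have hae : ∀ᵐ z ∂Γ', f (ι z) = h (z.1, z.2.1) := by
    filter_upwards [hξ, hζ] with ⟨x, t, ξ, ζ⟩ h1 h2
    simp only at h1 h2
    change f (toClosure x, t, ξ, ζ) = f (toClosure x, t, direction μ x, direction ν x)
    rcases h1 with h1 | rfl
    · have : t = 0 := Subtype.ext h1
      rw [this]; exact hf0 _ _ _ _ _
    rcases h2 with h2 | rfl
    · have : t = 1 := Subtype.ext (sub_eq_zero.1 h2).symm
      rw [this]; exact hf1 _ _ _ _ _
    rfl
  have hq : Measurable fun z : Ω × Icc (0 : ℝ) 1 × USphere d × USphere d => (z.1, z.2.1) := by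
    fun_prop
  set ρ : Measure (Ω × Icc (0 : ℝ) 1) := Γ'.map fun z => (z.1, z.2.1) with hρ
  have hρfst : ρ.fst = μ.variation + ν.variation := by
    rw [← hmarg, hρ, Measure.fst, Measure.map_map measurable_fst hq]
    rfl
  have hfin : IsFiniteMeasure Γ' := by
    rw [hΓ']; infer_instance
  -- Both sides compute `|μ|(s)`: one through the marginal of `τΓ'`, the other through the density
  -- of `|μ|`.
  have hbar : ∀ s, MeasurableSet s →
      ∫ p in Prod.fst ⁻¹' s, (p.2 : ℝ) ∂ρ = ∫ x in s, (ratio μ ν x : ℝ) ∂ρ.fst := by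
    intro s hs
    have h1 : ∫⁻ z in Prod.fst ⁻¹' s, ENNReal.ofReal (z.2.1 : ℝ) ∂Γ' = μ.variation s := by
      rw [← withDensity_apply _ (measurable_fst hs), ← hmarg1, Measure.map_apply measurable_fst hs]
    have h2 : ∫⁻ x in s, ENNReal.ofReal (ratio μ ν x) ∂(μ.variation + ν.variation) =
        μ.variation s := by
      rw [← withDensity_apply _ hs, withDensity_ratio]
    rw [hρfst, hρ, setIntegral_map (measurable_fst hs) (by fun_prop) hq.aemeasurable,
      integral_eq_lintegral_of_nonneg_ae (ae_of_all _ fun z => z.2.1.2.1) (by fun_prop),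
      integral_eq_lintegral_of_nonneg_ae (ae_of_all _ fun x => (ratio μ ν x).2.1)
        (measurable_subtype_coe.comp (measurable_ratio μ ν)).aestronglyMeasurable, h2]
    exact congrArg ENNReal.toReal h1
  have hJ := integral_barycenter_le ρ (measurable_ratio μ ν) hbar hhm (fun p => hC _)
    (fun x => hf.comp (g := fun t => (toClosure x, t, direction μ x, direction ν x))
      (by fun_prop))
    (fun x => hconv x (direction μ x) (direction ν x))
  rw [hint, integral_congr_ae hae]
  rw [hρfst, hρ, integral_map hq.aemeasurable hhm.aestronglyMeasurable] at hJ
  exact hJ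

end Limit

end TwoMeasures

end

/-! ### Conclusion by contradiction -/

theorem theorem4p1 {n d : ℕ} [NeZero d] (Ω : Set (EuclideanSpace ℝ (Fin n)))
    (hΩ : IsOpen Ω) (hΩb : Bornology.IsBounded Ω)
    (f : closure Ω × Set.Icc (0 : ℝ) 1 × TwoMeasures.USphere d × TwoMeasures.USphere d → ℝ)
    (hf : LowerSemicontinuous f) (hfb : ∃ C : ℝ, ∀ p, |f p| ≤ C)
    (hf0 : ∀ (x : Ω) (ξ ζ ξ' ζ' : TwoMeasures.USphere d),
      f (TwoMeasures.toClosure x, 0, ξ, ζ) = f (TwoMeasures.toClosure x, 0, ξ', ζ'))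
    (hf1 : ∀ (x : Ω) (ξ ζ ξ' ζ' : TwoMeasures.USphere d),
      f (TwoMeasures.toClosure x, 1, ξ, ζ) = f (TwoMeasures.toClosure x, 1, ξ', ζ'))
    (hconv : ∀ (x : Ω) (ξ ζ : TwoMeasures.USphere d),
      ConvexOn ℝ (Set.Icc (0 : ℝ) 1)
        (Set.IccExtend zero_le_one fun τ => f (TwoMeasures.toClosure x, τ, ξ, ζ)))
    (μs νs : ℕ → TwoMeasures.VMeas Ω d) (μ ν : TwoMeasures.VMeas Ω d)
    (hμ : TwoMeasures.StrictConverges μs μ) (hν : TwoMeasures.StrictConverges νs ν) :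
    (TwoMeasures.functional f μ ν : EReal) ≤
      Filter.liminf (fun k => (TwoMeasures.functional f (μs k) (νs k) : EReal)) Filter.atTop := by
  obtain ⟨C, hC⟩ := hfb
  by_contra! hlt
  obtain ⟨a, ha1, ha2⟩ := EReal.lt_iff_exists_real_btwn.1 hlt
  have hfreq := frequently_lt_of_liminf_lt (by isBoundedDefault) ha1
  -- This ultrafilter replaces a subsequence: it refines `atTop`, contains the indices with value
  -- below `a`, and makes bounded measures converge.
  let U : Ultrafilter ℕ := @Ultrafilter.of _
    (atTop ⊓ 𝓟 {k | (TwoMeasures.functional f (μs k) (νs k) : EReal) < a})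
    (frequently_iff_neBot.1 hfreq)
  have hU := @Ultrafilter.of_le _
    (atTop ⊓ 𝓟 {k | (TwoMeasures.functional f (μs k) (νs k) : EReal) < a})
    (frequently_iff_neBot.1 hfreq)
  have hUtop : (U : Filter ℕ) ≤ atTop := hU.trans inf_le_left
  have hUa : ∀ᶠ k in U, TwoMeasures.functional f (μs k) (νs k) ≤ a := by
    have : ∀ᶠ k in U, (TwoMeasures.functional f (μs k) (νs k) : EReal) < a :=
      le_principal_iff.1 (hU.trans inf_le_right)
    filter_upwards [this] with k hk
    exact (EReal.coe_lt_coe_iff.1 hk).le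
  have : CompactSpace (closure Ω) := isCompact_iff_compactSpace.1 hΩb.isCompact_closure
  let T : ℕ → Ω → TwoMeasures.Dom Ω d := fun k x => (TwoMeasures.toClosure x,
    TwoMeasures.ratio (μs k) (νs k) x, TwoMeasures.direction (μs k) x,
    TwoMeasures.direction (νs k) x)
  have hT : ∀ k, Measurable (T k) := fun k =>
    (continuous_inclusion subset_closure).measurable.prodMk ((TwoMeasures.measurable_ratio _ _).prodMk
      ((TwoMeasures.measurable_direction _).prodMk (TwoMeasures.measurable_direction _)))
  -- The summand `1` leaves room above the limit of the masses, so that the bound holds eventually.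
  have hmass : ∀ᶠ k in U, ((μs k).variation + (νs k).variation).map (T k) univ ≤
      μ.variation univ + ν.variation univ + 1 := by
    have h1 := ((hμ.2.add hν.2).mono_left hUtop).eventually_le_const
      (ENNReal.lt_add_right (ENNReal.add_ne_top.2
        ⟨measure_ne_top μ.variation univ, measure_ne_top ν.variation univ⟩) one_ne_zero)
    filter_upwards [h1] with k hk
    rw [Measure.map_apply (hT k) MeasurableSet.univ]
    exact hk
  obtain ⟨Γ, hΓfin, hΓ, hΓa⟩ := TwoMeasures.exists_weak_limit U
    (fun k => ((μs k).variation + (νs k).variation).map (T k))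
    (ENNReal.add_ne_top.2 ⟨ENNReal.add_ne_top.2
      ⟨measure_ne_top μ.variation univ, measure_ne_top ν.variation univ⟩, ENNReal.one_ne_top⟩)
    hmass hf hC (a := a) (by
      filter_upwards [hUa] with k hk
      rw [integral_map (hT k).aemeasurable hf.measurable.aestronglyMeasurable]
      exact hk)
  have := TwoMeasures.functional_le_integral_of_weak_limit hΩ hf hC hf0 hf1 hconv hμ hν hUtop hΓ
  exact absurd (EReal.coe_lt_coe_iff.1 ha2) (not_lt.2 (this.trans hΓa))
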